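/- **Setting.** For $n\ge 1$, an encoding function into $n$ bitstrings is a bijection $\sigma\colon\{0,1,\dots,2^n-1\}\to\{0,1\}^n$; let $\mathsf{Encf}_n$ be the (finite) set of all of them. For $1\le N\le 2^n$ identify $\mathbb Z_N$ with $\{0,\dots,N-1\}$. A generic algorithm is a probabilistic oracle Turing machine which takes as input a list $\sigma(x_1),\dots,\sigma(x_r)$ with $x_1,\dots,x_r\in\mathbb Z_N$, together with $N$ in binary and the prime factorization of $N$, which may query oracles for $add(\sigma(x),\sigma(y))=\sigma(x+y)$ and $inv(\sigma(x))=\sigma(-x)$ on $\sigma(\mathbb Z_N)$ (one query costs one step; a query about strings outside $\sigma(\mathbb Z_N)$ is answered by the empty string), and which outputs a binary string $\mathcal A(N;\sigma(x_1),\dots,\sigma(x_r))$. Let $\mathcal M_1,\mathcal M_2,\dots$ be a recursive enumeration of all such machines, and let $\mathcal A_k$ be the $k$-th polynomial-time generic algorithm: it executes $\mathcal M_k$ for at most $\ell^k+k$ steps, where $\ell$ is the length of the input, and its output is what then stands on the output tape. For $\sigma\in\mathsf{Encf}_n$, the experiment $\mathsf{DLog}_{\mathcal A}(n,\sigma)$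 chooses a prime $p$ with exactly $n$ bits uniformly, then $x\in\mathbb Z_p$ uniformly, and has output $1$ if $\mathcal A(p;\sigma(1),\sigma(x))$ is a binary representation of $x$, and $0$ otherwise. **Theorem 8.2.** The discrete logarithm problem is effectively hard in the generic group model. That is, recursive enumerations $\mathcal M_1,\mathcal M_2,\dots$ as above exist, and for each of them there is a computable function $f\colon\mathbb N^+\times\mathbb N^+\to\mathbb N^+$ such that for all $k,d,n\in\mathbb N^+$ with $n\ge f(k,d)$, $$\frac1{\#\mathsf{Encf}_n}\sum_{\sigma\in\mathsf{Encf}_n}\Pr\bigl[\mathsf{DLog}_{\mathcal A_k}(n,\sigma)=1\bigr]\le\frac1{n^d}.$$ More precisely, there is a constant $C\in\mathbb N^+$, which does not depend on the enumeration, such that one can take $$f(k,d)=\max\{(2k+d+1)^2,\,2C\}$$ for every such enumeration; this function is computable, and even computable in polynomial time (in the binary lengths of $k$ and $d$). -/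

import Mathlib

open scoped BigOperators

namespace GGM

/-! ### Probabilistic oracle Turing machines

Multi-tape machines with one-way infinite tapes.  Tape symbols and states are natural numbers; since
the transition table of a machine is a finite list, only finitely many of them matter to it.
The symbol `0` is the blank, `1` and `2` are the bits 0 and 1, `3` is the separator in inputs, and
all further symbols are at the free disposal of a machine.

Tape `0` is the input tape, tapes `1` and `2` hold the arguments of oracle queries, tape `3` receives
the answers, tape `4` is the output tape, and tapes `5, 6, …` are work tapes. -/

/-- Head movements. -/
inductive Move
  | left | stay | right

/-- What a transition asks of the oracles: nothing, the group operation, or the inverse. -/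
inductive Call
  | none | add | inv

def Move.equivFin : Move ≃ Fin 3 where
  toFun | .left => 0 | .stay => 1 | .right => 2
  invFun | 0 => .left | 1 => .stay | 2 => .right
  left_inv m := by cases m <;> rfl
  right_inv i := by fin_cases i <;> rfl

def Call.equivFin : Call ≃ Fin 3 where
  toFun | .none => 0 | .add => 1 | .inv => 2
  invFun | 0 => .none | 1 => .add | 2 => .inv
  left_inv m := by cases m <;> rfl
  right_inv i := by fin_cases i <;> rfl

instance : Primcodable Move := Primcodable.ofEquiv _ Move.equivFin
instance : Primcodable Call := Primcodable.ofEquiv _ Call.equivFin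

/-- One entry of a transition table: in state `state`, with coin toss `coin`, and with the symbols
`reads` under the heads (tape `0` first), write and move on the tapes as `acts` says (tape `0` first),
make the oracle query `call`, and go to state `next`. -/
structure Rule where
  state : ℕ
  coin : Bool
  reads : List ℕ
  next : ℕ
  acts : List (ℕ × Move)
  call : Call

/-- A probabilistic oracle Turing machine: its number of work tapes and its transition table.
The first entry that matches is used. -/
structure Machine where
  workTapes : ℕ
  rules : List Rule

def Rule.equivProd : Rule ≃ ℕ × Bool × List ℕ × ℕ × List (ℕ × Move) × Call where
  toFun r := (r.state, r.coin, r.reads, r.next, r.acts, r.call)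
  invFun t := ⟨t.1, t.2.1, t.2.2.1, t.2.2.2.1, t.2.2.2.2.1, t.2.2.2.2.2⟩
  left_inv _ := rfl
  right_inv _ := rfl

instance : Primcodable Rule := Primcodable.ofEquiv _ Rule.equivProd

def Machine.equivProd : Machine ≃ ℕ × List Rule where
  toFun m := (m.workTapes, m.rules)
  invFun t := ⟨t.1, t.2⟩
  left_inv _ := rfl
  right_inv _ := rfl

instance : Primcodable Machine := Primcodable.ofEquiv _ Machine.equivProd

/-- A one-way infinite tape: the cells left of the head, nearest first, and the cells from the head
on; all cells not listed are blank. -/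
structure Tape where
  left : List ℕ
  right : List ℕ

namespace Tape

/-- The tape with the word `w` in its first cells and the head on the first cell. -/
def ofWord (w : List ℕ) : Tape := ⟨[], w⟩

def head (t : Tape) : ℕ := t.right.headD 0

def write (t : Tape) (s : ℕ) : Tape := ⟨t.left, s :: t.right.tail⟩

/-- Moving left on the first cell has no effect. -/
def move (t : Tape) : Move → Tape
  | .left => match t.left with
    | [] => t
    | a :: l => ⟨l, a :: t.right⟩
  | .stay => t
  | .right => ⟨t.head :: t.left, t.right.tail⟩

/-- The binary string on a tape: the longest block of bits that starts in the first cell. -/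
def bits (t : Tape) : List Bool :=
  ((t.left.reverse ++ t.right).takeWhile fun s => s == 1 || s == 2).map fun s => s == 2

end Tape

/-- The word of tape symbols for a binary string. -/
def symbols (u : List Bool) : List ℕ := u.map fun b => if b then 2 else 1

/-- A pair of oracles: a binary and a unary function on binary strings. -/
structure Oracle where
  add : List Bool → List Bool → List Bool
  inv : List Bool → List Bool

/-- A configuration: the state and the tapes. -/
structure Config where
  state : ℕ
  tapes : ℕ → Tape

namespace Machine

/-- The start configuration on the input word `w`: state `0`, all other tapes empty. -/
def init (w : List ℕ) : Config where
  state := 0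
  tapes i := Tape.ofWord (if i = 0 then w else [])

/-- The symbols under the heads. -/
def scan (m : Machine) (c : Config) : List ℕ :=
  (List.range (5 + m.workTapes)).map fun i => (c.tapes i).head

/-- The tapes after the writes and moves of the rule `r` (a tape that `r` does not mention is left
alone). -/
def act (r : Rule) (T : ℕ → Tape) (i : ℕ) : Tape :=
  match r.acts[i]? with
  | some a => ((T i).write a.1).move a.2
  | none => T i

/-- The effect of an oracle query on the tapes; it takes no further step. -/
def query (O : Oracle) (q : Call) (T : ℕ → Tape) : ℕ → Tape :=
  match q with
  | .none => T
  | .add => Function.update T 3 (Tape.ofWord (symbols (O.add (T 1).bits (T 2).bits)))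
  | .inv => Function.update T 3 (Tape.ofWord (symbols (O.inv (T 1).bits)))

/-- One step with coin toss `b`.  Nothing happens if no rule applies; a machine halts by entering a
state in which no rule applies. -/
def step (m : Machine) (O : Oracle) (c : Config) (b : Bool) : Config :=
  match m.rules.find? fun r => r.state == c.state && r.coin == b && r.reads == m.scan c with
  | some r => ⟨r.next, query O r.call (act r c.tapes)⟩
  | none => c

/-- The string on the output tape after running `m` on the input word `w` for as many steps as there
are coin tosses in `coins` (fewer, if it halts before). -/
def output (m : Machine) (O : Oracle) (w : List ℕ) (coins : List Bool) : List Bool :=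
  ((coins.foldl (m.step O) (init w)).tapes 4).bits

end Machine

/-! ### Encoding functions and the generic group oracles -/

/-- Encoding functions into `n` bitstrings: bijections from `{0, …, 2 ^ n - 1}` to `{0,1} ^ n`. -/
abbrev Encf (n : ℕ) : Type := Fin (2 ^ n) ≃ (Fin n → Bool)

/-- The binary string `σ(x)`, for `x < 2 ^ n` (the reduction modulo `2 ^ n` is void then). -/
def code {n : ℕ} (σ : Encf n) (x : ℕ) : List Bool :=
  List.ofFn (σ ⟨x % 2 ^ n, Nat.mod_lt x (Nat.two_pow_pos n)⟩)

/-- The element `x ∈ {0, …, N - 1}` with `σ(x) = u`, if there is one (for `N ≤ 2 ^ n`). -/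
def decode {n : ℕ} (σ : Encf n) (N : ℕ) (u : List Bool) : Option ℕ :=
  (List.range N).find? fun x => code σ x == u

/-- The oracles of a generic algorithm: `add(σ(x), σ(y)) = σ(x + y)` and `inv(σ(x)) = σ(-x)` for
`x, y ∈ ℤ_N`.  Queries about strings outside of `σ(ℤ_N)` are answered by the empty string. -/
def groupOracle {n : ℕ} (σ : Encf n) (N : ℕ) : Oracle where
  add u v := match decode σ N u, decode σ N v with
    | some x, some y => code σ ((x + y) % N)
    | _, _ => []
  inv u := match decode σ N u with
    | some x => code σ ((N - x) % N)
    | none => []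

/-- The binary representation of a number, most significant bit first. -/
def binary (N : ℕ) : List Bool := N.bits.reverse

/-- The number that a binary string represents, most significant bit first. -/
def value (u : List Bool) : ℕ := u.foldl (fun a b => 2 * a + b.toNat) 0

/-- The input word of a generic algorithm: the number `N`, its prime factorization (the primes in
increasing order, with multiplicity) and a list of encoded group elements, each string being followed
by the separator. -/
def inputWord (N : ℕ) (l : List (List Bool)) : List ℕ :=
  (binary N :: (N.primeFactorsList.map binary ++ l)).flatMap fun u => symbols u ++ [3]

/-! ### The discrete logarithm experiment -/

/-- The number of steps granted to the `k`-th polynomial-time generic algorithm on the input word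
`w`. -/
def clock (k : ℕ) (w : List ℕ) : ℕ := w.length ^ k + k

/-- The output string of the `k`-th polynomial-time generic algorithm, which executes `M k` for at
most `clock k w` steps, when its coin tosses are `coins`. -/
def polyOutput (M : ℕ → Machine) (k : ℕ) (O : Oracle) (w : List ℕ) (coins : Fin (clock k w) → Bool) :
    List Bool :=
  (M k).output O w (List.ofFn coins)

/-- The primes of exactly `n` bits. -/
def nBitPrimes (n : ℕ) : Finset ℕ := (Finset.Ico (2 ^ (n - 1)) (2 ^ n)).filter Nat.Prime

/-- The probability, over the coin tosses, that the `k`-th polynomial-time generic algorithm on input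
`σ(1), σ(x)` in the group `σ(ℤ_p)` outputs `x` in binary. -/
noncomputable def successProb (M : ℕ → Machine) (k : ℕ) {n : ℕ} (σ : Encf n) (p x : ℕ) : ℝ :=
  let w := inputWord p [code σ 1, code σ x]
  𝔼 coins : Fin (clock k w) → Bool,
    if value (polyOutput M k (groupOracle σ p) w coins) = x then (1 : ℝ) else 0

/-- The probability that the discrete logarithm experiment outputs `1` for the `k`-th polynomial-time
generic algorithm and the encoding function `σ`: an `n`-bit prime `p` and then `x ∈ ℤ_p` are chosen
uniformly. -/
noncomputable def dlogProb (M : ℕ → Machine) (k : ℕ) {n : ℕ} (σ : Encf n) : ℝ :=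
  𝔼 p ∈ nBitPrimes n, 𝔼 x ∈ Finset.range p, successProb M k σ p x

/-! ### Effective hardness -/

/-- `M 1, M 2, …` is a recursive enumeration of all generic algorithms. -/
def IsRecursiveEnumeration (M : ℕ → Machine) : Prop :=
  Computable M ∧ ∀ m : Machine, ∃ k, 1 ≤ k ∧ M k = m

/-- `f` is computable, and for all `k, d ≥ 1` it is a security level from which on the average success
probability of the `k`-th polynomial-time generic algorithm is at most `1 / n ^ d`. -/
def IsEffectiveThreshold (M : ℕ → Machine) (f : ℕ → ℕ → ℕ) : Prop :=
  Computable₂ f ∧ ∀ k d n : ℕ, 1 ≤ k → 1 ≤ d → 1 ≤ n → f k d ≤ n →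
    (𝔼 σ : Encf n, dlogProb M k σ) ≤ 1 / (n : ℝ) ^ d

/-- The discrete logarithm problem is effectively hard in the generic group model (with respect to the
enumeration of the polynomial-time generic algorithms that is given by `M`). -/
def DLogEffectivelyHard (M : ℕ → Machine) : Prop :=
  ∃ f : ℕ → ℕ → ℕ, IsEffectiveThreshold M f

/-- `f` is computable in polynomial time, in the lengths of the binary representations of its
arguments. -/
def IsPolyTime (f : ℕ → ℕ → ℕ) : Prop :=
  Nonempty (Turing.TM2ComputableInPolyTime
    (Computability.encodingProd Computability.encodingNatBool Computability.encodingNatBool).encode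
    Computability.encodingNatBool.encode (fun a : ℕ × ℕ => f a.1 a.2))

/-- The explicit threshold. -/
def threshold (C k d : ℕ) : ℕ := max ((2 * k + d + 1) ^ 2) (2 * C)

end GGM

/-!
Shoup's argument: to a generic algorithm the encoding function looks random, and all that it can ever
compute are encodings of affine functions `a + b * x` of the secret `x`.  Until two different affine
functions take the same value at `x`, the answers of the oracles are independent of `x`; and over a
prime field two different affine functions agree at one `x` at most.

This is carried out as a count.  For a fixed prime and fixed coin tosses, a list of entries
`σ (f x) = u` records what has been revealed about the encoding function `σ` and the secret `x`, and
`count` is the number of pairs `(σ, x)` that are consistent with it and lead to success.  With `m`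
entries there are at most `(2 ^ n - m)!` consistent `σ` for each `x`.  A computation is followed step by
step: `count_le_of_image` splits the count according to a newly revealed encoding, where collisions
concern at most `m` secrets, and `count_le_of_preimage` splits it according to what a string encodes
that the algorithm has made up.  When no step is left, the output is a fixed number, which agrees with
one secret at most.  So `T` steps succeed with probability `O(T ^ 2) / p` (`count_output_le`), where
`T = (4 * n + 4) ^ k + k` and `p ≥ 2 ^ (n - 1)`, and `bound_mul_pow_le` shows that this is at most
`1 / n ^ d` as soon as `n ≥ max ((2 * k + d + 1) ^ 2) 256`.

With the constant `128` the threshold is the square of `max (2 * k + d + 1) 16`.  It is computed in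
polynomial time by an explicit stack machine, which adds in binary, replaces a result of at most four
bits by `16`, and squares by Horner's scheme (`Square.run`).  A recursive enumeration of the machines is
given by the decoding function of the (primitive recursive) encoding of machines by numbers.
-/

namespace GGM

/-! ### Binary arithmetic on lists of bits -/

/-- The sum digit of a full adder. -/
def sumBit (a b c : Bool) : Bool := (a ^^ b) ^^ c

/-- The carry of a full adder. -/
def carryBit (a b c : Bool) : Bool := (a && b) || (c && (a || b))

/-- Addition with carry of two bit strings, least significant bit first. -/
def addBits : Bool → List Bool → List Bool → List Bool
  | c, [], [] => bif c then [true] else []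
  | c, a :: x, [] => sumBit a false c :: addBits (carryBit a false c) x []
  | c, [], b :: y => sumBit false b c :: addBits (carryBit false b c) [] y
  | c, a :: x, b :: y => sumBit a b c :: addBits (carryBit a b c) x y

theorem length_addBits_le (c : Bool) (x y : List Bool) :
    (addBits c x y).length ≤ max x.length y.length + 1 := by
  induction c, x, y using addBits.induct <;> simp_all [addBits]

theorem encodeNat_eq_bits (n : ℕ) : Computability.encodeNat n = n.bits := by
  have pos : ∀ m : PosNum, Computability.encodePosNum m = (m : ℕ).bits := by
    intro m
    induction m with
    | one => simp [Computability.encodePosNum]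
    | bit0 m ih =>
      have h : ((PosNum.bit0 m : PosNum) : ℕ) = Nat.bit false m := by
        simp [PosNum.cast_bit0, Nat.bit_val, two_mul]
      rw [h, Nat.bits_append_bit _ _ (fun h0 => absurd h0 (PosNum.cast_pos m).ne'), ← ih]
      rfl
    | bit1 m ih =>
      have h : ((PosNum.bit1 m : PosNum) : ℕ) = Nat.bit true m := by
        simp [PosNum.cast_bit1, Nat.bit_val, two_mul]
      rw [h, Nat.bits_append_bit _ _ (fun _ => rfl), ← ih]
      rfl
  rw [Computability.encodeNat]
  conv_rhs => rw [← Num.to_of_nat n]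
  cases (n : Num) with
  | zero => simp [Computability.encodeNum]
  | pos m => simpa [Computability.encodeNum] using pos m

theorem bits_two_mul_add (n : ℕ) (b : Bool) (h : n = 0 → b = true) :
    (2 * n + b.toNat).bits = b :: n.bits := by
  rw [← Nat.bit_val, Nat.bits_append_bit _ _ h]

theorem bits_eq_cons {n : ℕ} (hn : n ≠ 0) :
    ∃ (b : Bool) (m : ℕ), (m = 0 → b = true) ∧ n = 2 * m + b.toNat ∧ n.bits = b :: m.bits := by
  have key : (n / 2 = 0 → n.bodd = true) ∧ n = 2 * (n / 2) + n.bodd.toNat := by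
    have := Nat.bodd_add_div2 n
    rw [Nat.div2_val] at this
    refine ⟨fun h => ?_, by omega⟩
    cases hb : n.bodd
    · rw [hb, h] at this; simp at this; omega
    · rfl
  refine ⟨n.bodd, n / 2, key.1, key.2, ?_⟩
  conv_lhs => rw [key.2]
  exact bits_two_mul_add _ _ key.1

theorem sumBit_carryBit (a b c : Bool) :
    2 * (carryBit a b c).toNat + (sumBit a b c).toNat = a.toNat + b.toNat + c.toNat := by
  cases a <;> cases b <;> cases c <;> rfl

theorem addBits_bits (c : Bool) (m n : ℕ) :
    addBits c m.bits n.bits = (m + n + c.toNat).bits := by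
  induction m using Nat.strong_induction_on generalizing n c with
  | _ m ih =>
  induction n using Nat.strong_induction_on generalizing m c with
  | _ n ihn =>
  by_cases hm : m = 0
  · subst hm
    by_cases hn : n = 0
    · subst hn
      cases c <;> simp [addBits]
    · obtain ⟨b, n', hb, hn', hbits⟩ := bits_eq_cons hn
      have hlt : n' < n := by cases b <;> simp_all <;> omega
      have := ihn n' hlt 0 (fun k hk => absurd hk (by omega)) (carryBit false b c)
      rw [hbits, Nat.zero_bits, addBits]
      rw [Nat.zero_bits] at this
      have e := sumBit_carryBit false b c
      rw [this, ← bits_two_mul_add]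
      · congr 1; simp at e; omega
      · intro h
        clear ih ihn this hbits e
        cases b <;> cases c <;> simp_all [sumBit, carryBit]
  · obtain ⟨a, m', ha, hm', hmbits⟩ := bits_eq_cons hm
    have hltm : m' < m := by cases a <;> simp_all <;> omega
    by_cases hn : n = 0
    · subst hn
      have := ih m' hltm (carryBit a false c) 0
      rw [hmbits, Nat.zero_bits, addBits]
      rw [Nat.zero_bits] at this
      have e := sumBit_carryBit a false c
      rw [this, ← bits_two_mul_add]
      · congr 1; simp at e; omega
      · intro h
        clear ih ihn this hmbits e
        cases a <;> cases c <;> simp_all [sumBit, carryBit]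
    · obtain ⟨b, n', hb, hn', hbits⟩ := bits_eq_cons hn
      have := ih m' hltm (carryBit a b c) n'
      rw [hmbits, hbits, addBits]
      have e := sumBit_carryBit a b c
      rw [this, ← bits_two_mul_add]
      · congr 1; omega
      · intro h
        clear ih ihn this hmbits hbits e
        cases a <;> cases b <;> cases c <;> simp_all [carryBit]

/-- The doubled summand may be the non-canonical representation `[false]` of zero. -/
theorem addBits_double_bits (m n : ℕ) (hn : n ≠ 0) :
    addBits false (false :: m.bits) n.bits = (2 * m + n).bits := by
  obtain ⟨b, n', hb, hn', hbits⟩ := bits_eq_cons hn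
  rw [hbits, addBits, addBits_bits, ← bits_two_mul_add]
  · congr 1
    have e := sumBit_carryBit false b false
    simp at e; omega
  · intro h
    cases b <;> simp_all [sumBit, carryBit]

theorem getLast?_bits (n : ℕ) : ∀ b ∈ n.bits.getLast?, b = true := by
  induction n using Nat.strong_induction_on with
  | _ n ih =>
  by_cases hn : n = 0
  · simp [hn]
  · obtain ⟨b, m, hb, hm, hbits⟩ := bits_eq_cons hn
    have hlt : m < n := by cases b <;> simp_all <;> omega
    rw [hbits]
    by_cases h0 : m = 0
    · simp [h0, hb h0]
    · obtain ⟨b', m', -, -, hbits'⟩ := bits_eq_cons h0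
      have := ih m hlt
      rw [hbits'] at this ⊢
      rwa [List.getLast?_cons_cons]

/-- Horner's scheme for the product of `N` and the number with the bits `g`, most significant bit
first, started at `m`. -/
def horner (N m : ℕ) (g : List Bool) : ℕ := g.foldl (fun m b => 2 * m + b.toNat * N) m

theorem horner_reverse_bits (N M : ℕ) : horner N 0 M.bits.reverse = M * N := by
  rw [horner, List.foldl_reverse]
  induction M using Nat.strong_induction_on with
  | _ M ih =>
  by_cases hM : M = 0
  · simp [hM]
  · obtain ⟨b, m, hb, hm, hbits⟩ := bits_eq_cons hM
    have hlt : m < M := by cases b <;> simp_all <;> omega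
    rw [hbits, List.foldr_cons, ih m hlt, hm]
    ring

/-! ### A stack machine that squares -/

open Turing

namespace Square

/-- The stacks: the input, the number `N` to be squared, its bits not yet processed, the output, and
two auxiliary stacks. -/
inductive Stack
  | inp | num | todo | acc | aux | copy
  deriving DecidableEq

instance : Fintype Stack :=
  ⟨{.inp, .num, .todo, .acc, .aux, .copy}, fun k => by cases k <;> decide⟩

/-- The labels of the program. -/
inductive Label
  | load | double | add | check | pad | restore | main | mul | clear
  deriving DecidableEq

instance : Fintype Label :=
  ⟨{.load, .double, .add, .check, .pad, .restore, .main, .mul, .clear}, fun l => by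
    cases l <;> decide⟩

/-- The input is a pair of numbers in the alphabet of `Computability.encodingProd`; all other stacks
hold bits. -/
abbrev Alphabet : Stack → Type
  | .inp => Bool ⊕ Bool
  | _ => Bool

/-- The internal state: two digits just read, a carry, and a counter that saturates at `5`. -/
structure Var where
  x : Option Bool
  y : Option Bool
  carry : Bool
  count : Fin 6
  deriving DecidableEq, Fintype

/-- Counting up to `5`. -/
def satSucc (i : Fin 6) : Fin 6 := ⟨min (i + 1) 5, by omega⟩

theorem satSucc_iterate (n : ℕ) : ((satSucc^[n] 0 : Fin 6) : ℕ) = min n 5 := by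
  induction n with
  | zero => rfl
  | succ n ih => rw [Function.iterate_succ_apply', satSucc]; simp only [ih]; omega

namespace Var

def setX (v : Var) (o : Option Bool) : Var := { v with x := o }
def setY (v : Var) (o : Option Bool) : Var := { v with y := o }

/-- Forget the digits just read. -/
def reset (v : Var) : Var := { v with x := none, y := none }

def some? (v : Var) : Bool := v.x.isSome || v.y.isSome

def digit (v : Var) : Bool := sumBit (v.x.getD false) (v.y.getD false) v.carry

/-- Forget the digits just read, and update the carry. -/
def advance (v : Var) : Var :=
  { v with x := none, y := none, carry := carryBit (v.x.getD false) (v.y.getD false) v.carry }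

def tick (v : Var) : Var := { v with count := satSucc v.count }

/-- The internal state at the start and at the end. -/
def start : Var := ⟨none, none, false, 0⟩

end Var

open TM2.Stmt in
/-- The program: it computes `N = 2 * k + d + 1` from the input `(k, d)`, replaces `N` by `16` if it
has at most four bits, and squares the result by Horner's scheme. -/
def program : Label → TM2.Stmt Alphabet Label Var
  | .load =>
    peek .inp (fun v o => v.setX (o.bind Sum.getLeft?)) <|
    branch (fun v => v.x.isSome)
      (pop .inp (fun v _ => v) <| push .copy (fun v => v.x.getD false) <| load Var.reset <|
        goto fun _ => .load)
      (goto fun _ => .double)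
  | .double =>
    pop .copy Var.setX <|
    branch (fun v => v.x.isSome)
      (push .num (fun v => v.x.getD false) <| load Var.reset <| goto fun _ => .double)
      (push .num (fun _ => true) <| goto fun _ => .add)
  | .add =>
    pop .num Var.setX <| pop .inp (fun v o => v.setY (o.map (Sum.elim id id))) <|
    branch Var.some?
      (push .copy Var.digit <| push .todo Var.digit <| load Var.advance <| load Var.tick <|
        goto fun _ => .add)
      (branch (fun v => v.carry)
        (push .copy (fun _ => true) <| push .todo (fun _ => true) <| load Var.advance <|
          load Var.tick <| goto fun _ => .check)
        (goto fun _ => .check))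
  | .check =>
    branch (fun v => v.count = 5)
      (load (fun _ => Var.start) <| goto fun _ => .restore)
      (load (fun _ => Var.start) <| goto fun _ => .pad)
  | .pad =>
    pop .copy Var.setX <| pop .todo Var.setY <|
    branch Var.some?
      (load Var.reset <| goto fun _ => .pad)
      (push .copy (fun _ => false) <| push .copy (fun _ => false) <| push .copy (fun _ => false) <|
        push .copy (fun _ => false) <| push .copy (fun _ => true) <|
        push .todo (fun _ => false) <| push .todo (fun _ => false) <| push .todo (fun _ => false) <|
        push .todo (fun _ => false) <| push .todo (fun _ => true) <| goto fun _ => .restore)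
  | .restore =>
    pop .aux Var.setX <| pop .copy Var.setY <|
    branch (fun v => v.x.isSome)
      (push .acc (fun v => v.x.getD false) <|
        branch (fun v => v.y.isSome)
          (push .num (fun v => v.y.getD false) <| load Var.reset <| goto fun _ => .restore)
          (load Var.reset <| goto fun _ => .restore))
      (branch (fun v => v.y.isSome)
        (push .num (fun v => v.y.getD false) <| load Var.reset <| goto fun _ => .restore)
        (goto fun _ => .main))
  | .main =>
    pop .todo Var.setX <|
    branch (fun v => v.x.isSome)
      (push .acc (fun _ => false) <|
        branch (fun v => v.x.getD false)
          (load Var.reset <| goto fun _ => .mul)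
          (load Var.reset <| goto fun _ => .main))
      (goto fun _ => .clear)
  | .mul =>
    pop .acc Var.setX <| pop .num Var.setY <|
    branch Var.some?
      (push .aux Var.digit <|
        branch (fun v => v.y.isSome)
          (push .copy (fun v => v.y.getD false) <| load Var.advance <| goto fun _ => .mul)
          (load Var.advance <| goto fun _ => .mul))
      (branch (fun v => v.carry)
        (push .aux (fun _ => true) <| load Var.advance <| goto fun _ => .restore)
        (goto fun _ => .restore))
  | .clear =>
    pop .num Var.setX <|
    branch (fun v => v.x.isSome) (load Var.reset <| goto fun _ => .clear) halt

/-- The machine with the program `program`. -/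
def machine : FinTM2 where
  K := Stack
  k₀ := .inp
  k₁ := .acc
  Γ := Alphabet
  Λ := Label
  main := .load
  σ := Var
  initialState := Var.start
  Γk₀Fin := inferInstanceAs (Fintype (Bool ⊕ Bool))
  m := program

/-- The stacks with the given contents. -/
def conts (inp : List (Bool ⊕ Bool)) (num todo acc aux copy : List Bool) :
    (k : Stack) → List (Alphabet k)
  | .inp => inp
  | .num => num
  | .todo => todo
  | .acc => acc
  | .aux => aux
  | .copy => copy

section
variable (inp inp' : List (Bool ⊕ Bool)) (num todo acc aux copy l : List Bool)

@[simp] theorem update_inp : Function.update (conts inp num todo acc aux copy) .inp inp' =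
    conts inp' num todo acc aux copy := by
  funext k; cases k <;> simp [conts, Function.update]
@[simp] theorem update_num : Function.update (conts inp num todo acc aux copy) .num l =
    conts inp l todo acc aux copy := by
  funext k; cases k <;> simp [conts, Function.update]
@[simp] theorem update_todo : Function.update (conts inp num todo acc aux copy) .todo l =
    conts inp num l acc aux copy := by
  funext k; cases k <;> simp [conts, Function.update]
@[simp] theorem update_acc : Function.update (conts inp num todo acc aux copy) .acc l =
    conts inp num todo l aux copy := by
  funext k; cases k <;> simp [conts, Function.update]
@[simp] theorem update_aux : Function.update (conts inp num todo acc aux copy) .aux l =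
    conts inp num todo acc l copy := by
  funext k; cases k <;> simp [conts, Function.update]
@[simp] theorem update_copy : Function.update (conts inp num todo acc aux copy) .copy l =
    conts inp num todo acc aux l := by
  funext k; cases k <;> simp [conts, Function.update]
@[simp] theorem conts_inp : conts inp num todo acc aux copy .inp = inp := rfl
@[simp] theorem conts_num : conts inp num todo acc aux copy .num = num := rfl
@[simp] theorem conts_todo : conts inp num todo acc aux copy .todo = todo := rfl
@[simp] theorem conts_acc : conts inp num todo acc aux copy .acc = acc := rfl
@[simp] theorem conts_aux : conts inp num todo acc aux copy .aux = aux := rfl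
@[simp] theorem conts_copy : conts inp num todo acc aux copy .copy = copy := rfl

end

/-- The configurations of the machine. -/
abbrev Conf := TM2.Cfg Alphabet Label Var

/-- The machine gets from `c` to `c'` in at most `n` steps. -/
def Within (n : ℕ) (c c' : Conf) : Prop :=
  ∃ m ≤ n, (flip bind (TM2.step program))^[m] (some c) = some c'

theorem Within.refl (c : Conf) : Within 0 c c := ⟨0, le_rfl, rfl⟩

theorem Within.mono {n n' : ℕ} {c c' : Conf} (h : Within n c c') (hn : n ≤ n') : Within n' c c' :=
  let ⟨m, hm, e⟩ := h; ⟨m, hm.trans hn, e⟩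

theorem Within.trans {n n' : ℕ} {c c' c'' : Conf} (h : Within n c c') (h' : Within n' c' c'') :
    Within (n + n') c c'' := by
  obtain ⟨m, hm, e⟩ := h
  obtain ⟨m', hm', e'⟩ := h'
  exact ⟨m' + m, by omega, by rw [Function.iterate_add_apply, e, e']⟩

theorem Within.step {n : ℕ} (l : Label) (v : Var) (S : (k : Stack) → List (Alphabet k)) {c : Conf}
    (h : Within n (TM2.stepAux (program l) v S) c) : Within (n + 1) ⟨some l, v, S⟩ c := by
  obtain ⟨m, hm, e⟩ := h
  exact ⟨m + 1, by omega, by rw [Function.iterate_succ_apply, ← e]; rfl⟩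

/-- The internal state between two passes through a loop. -/
abbrev idle (c : Bool) (i : Fin 6) : Var := ⟨none, none, c, i⟩

attribute [local simp] program Var.setX Var.setY Var.reset Var.some? Var.digit Var.advance
  Var.tick Var.start

/-- The loop at `load` reverses the first argument onto `copy`. -/
theorem load_loop (k d q : List Bool) :
    Within (k.length + 1)
      ⟨some .load, idle false 0, conts (k.map .inl ++ d.map .inr) [] [] [] [] q⟩
      ⟨some .double, idle false 0, conts (d.map .inr) [] [] [] [] (k.reverse ++ q)⟩ := by
  induction k generalizing q with
  | nil =>
    refine (Within.step _ _ _ ?_ (n := 0))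
    cases d <;> simp [Within.refl]
  | cons a k ih =>
    refine Within.step _ _ _ ?_
    simpa using ih (a :: q)

/-- The loop at `double` turns `k` into `2 * k + 1`. -/
theorem double_loop (inp : List (Bool ⊕ Bool)) (q f : List Bool) :
    Within (q.length + 1)
      ⟨some .double, idle false 0, conts inp f [] [] [] q⟩
      ⟨some .add, idle false 0, conts inp (true :: (q.reverse ++ f)) [] [] [] []⟩ := by
  induction q generalizing f with
  | nil =>
    refine (Within.step _ _ _ ?_ (n := 0))
    simp [Within.refl]
  | cons a k ih =>
    refine Within.step _ _ _ ?_
    simpa using ih (a :: f)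

/-- The loop at `add` leaves two reversed copies of the sum and counts its bits. -/
theorem add_loop (c : Bool) (x y g q : List Bool) (i : Fin 6) :
    Within (max x.length y.length + 1)
      ⟨some .add, idle c i, conts (y.map .inr) x g [] [] q⟩
      ⟨some .check, idle false (satSucc^[(addBits c x y).length] i),
        conts [] [] ((addBits c x y).reverse ++ g) [] [] ((addBits c x y).reverse ++ q)⟩ := by
  induction c, x, y using addBits.induct generalizing g q i with
  | case1 =>
    refine (Within.step _ _ _ ?_ (n := 0))
    simp [Within.refl, addBits, carryBit]
  | case2 =>
    refine (Within.step _ _ _ ?_ (n := 0))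
    simp [Within.refl, addBits]
  | case3 c a x ih =>
    refine (Within.step _ _ _ ?_).mono (n := max x.length 0 + 1 + 1) (by simp)
    simpa [addBits] using ih (sumBit a false c :: g) (sumBit a false c :: q) (satSucc i)
  | case4 c b y ih =>
    refine (Within.step _ _ _ ?_).mono (n := max 0 y.length + 1 + 1) (by simp)
    simpa [addBits] using ih (sumBit false b c :: g) (sumBit false b c :: q) (satSucc i)
  | case5 c a x b y ih =>
    refine (Within.step _ _ _ ?_).mono (n := max x.length y.length + 1 + 1) (by simp)
    simpa [addBits] using ih (sumBit a b c :: g) (sumBit a b c :: q) (satSucc i)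

/-- The loop at `pad` replaces the number by `16`. -/
theorem pad_loop (g : List Bool) :
    Within (g.length + 1)
      ⟨some .pad, idle false 0, conts [] [] g [] [] g⟩
      ⟨some .restore, idle false 0, conts [] [] (Nat.bits 16).reverse [] []
        (Nat.bits 16).reverse⟩ := by
  have h16 : Nat.bits 16 = [false, false, false, false, true] := by
    rw [← encodeNat_eq_bits]; decide
  induction g with
  | nil =>
    refine (Within.step _ _ _ ?_ (n := 0))
    simp [Within.refl, h16]
  | cons a g ih =>
    refine Within.step _ _ _ ?_
    simpa using ih

/-- The loop at `restore` reverses the auxiliary stacks onto `acc` and `num`, at the same time. -/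
theorem restore_loop (f g h p q : List Bool) :
    Within (max p.length q.length + 1)
      ⟨some .restore, idle false 0, conts [] f g h p q⟩
      ⟨some .main, idle false 0, conts [] (q.reverse ++ f) g (p.reverse ++ h) [] []⟩ := by
  induction p generalizing f h q with
  | nil =>
    induction q generalizing f with
    | nil =>
      refine (Within.step _ _ _ ?_ (n := 0))
      simp [Within.refl]
    | cons b q ih =>
      refine (Within.step _ _ _ ?_).mono (n := max 0 q.length + 1 + 1) (by simp)
      simpa using ih (b :: f)
  | cons a p ih =>
    cases q with
    | nil =>
      refine (Within.step _ _ _ ?_).mono (n := max p.length 0 + 1 + 1) (by simp)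
      simpa using ih f (a :: h) []
    | cons b q =>
      refine (Within.step _ _ _ ?_).mono (n := max p.length q.length + 1 + 1) (by simp)
      simpa using ih (b :: f) (a :: h) q

/-- The loop at `mul` adds `num` to `acc`; the sum and a copy of `num` are left in reverse. -/
theorem mul_loop (c : Bool) (x y g p q : List Bool) :
    Within (max x.length y.length + 1)
      ⟨some .mul, idle c 0, conts [] y g x p q⟩
      ⟨some .restore, idle false 0,
        conts [] [] g [] ((addBits c x y).reverse ++ p) (y.reverse ++ q)⟩ := by
  induction c, x, y using addBits.induct generalizing p q with
  | case1 =>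
    refine (Within.step _ _ _ ?_ (n := 0))
    simp [Within.refl, addBits, carryBit]
  | case2 =>
    refine (Within.step _ _ _ ?_ (n := 0))
    simp [Within.refl, addBits]
  | case3 c a x ih =>
    refine (Within.step _ _ _ ?_).mono (n := max x.length 0 + 1 + 1) (by simp)
    simpa [addBits] using ih (sumBit a false c :: p) q
  | case4 c b y ih =>
    refine (Within.step _ _ _ ?_).mono (n := max 0 y.length + 1 + 1) (by simp)
    simpa [addBits] using ih (sumBit false b c :: p) (b :: q)
  | case5 c a x b y ih =>
    refine (Within.step _ _ _ ?_).mono (n := max x.length y.length + 1 + 1) (by simp)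
    simpa [addBits] using ih (sumBit a b c :: p) (b :: q)

theorem clear_loop (f h : List Bool) :
    Within (f.length + 1) ⟨some .clear, idle false 0, conts [] f [] h [] []⟩
      ⟨none, idle false 0, conts [] [] [] h [] []⟩ := by
  induction f with
  | nil =>
    refine (Within.step _ _ _ ?_ (n := 0))
    simp [Within.refl]
  | cons a f ih =>
    refine Within.step _ _ _ ?_
    simpa using ih

/-- The main loop carries out Horner's scheme.  At the start `0` the first bit has to be `1`, because
doubling `[]` to `[false]` would leave a leading zero.  `A` bounds the lengths of the two numbers; each
pass lengthens the result by at most two bits. -/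
theorem main_loop (N : ℕ) (hN : N ≠ 0) (g : List Bool) (m : ℕ)
    (hg : m = 0 → ∀ b ∈ g.head?, b = true) (A : ℕ) (hA : max m.bits.length N.bits.length ≤ A) :
    Within (g.length * (2 * (A + 2 * g.length) + 6) + 1)
      ⟨some .main, idle false 0, conts [] N.bits g m.bits [] []⟩
      ⟨some .clear, idle false 0, conts [] N.bits [] (horner N m g).bits [] []⟩ := by
  induction g generalizing m A with
  | nil =>
    refine (Within.step _ _ _ ?_ (n := 0)).mono (by simp)
    simp [Within.refl, horner]
  | cons b g ih =>
    have hm0 : 2 * m + b.toNat * N ≠ 0 := by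
      rcases Nat.eq_zero_or_pos m with h | h
      · have := hg h b (by simp)
        subst this; simp [h, hN]
      · omega
    have hhorner : horner N m (b :: g) = horner N (2 * m + b.toNat * N) g := rfl
    have hrec := fun A' hA' => ih (2 * m + b.toNat * N) (fun h => absurd h hm0) A' hA'
    cases b with
    | false =>
      have hm : m ≠ 0 := by simpa using hm0
      have hb : (2 * m).bits = false :: m.bits := by
        simpa using bits_two_mul_add m false (fun h => absurd h hm)
      have hlen : (2 * m).bits.length = m.bits.length + 1 := by rw [hb]; rfl
      have := hrec (A + 2) (by simp [hlen]; omega)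
      refine (Within.step _ _ _ (n := g.length * (2 * (A + 2 + 2 * g.length) + 6) + 1) ?_).mono ?_
      · rw [hhorner]
        simpa [hb] using this
      · simp only [List.length_cons]; nlinarith
    | true =>
      have hb := addBits_double_bits m N hN
      have hlen := length_addBits_le false (false :: m.bits) N.bits
      rw [hb] at hlen
      simp only [List.length_cons] at hlen
      have h3 := hrec (A + 2) (by simp; omega)
      have h1 := mul_loop false (false :: m.bits) N.bits g [] []
      have h2 := restore_loop [] g [] (2 * m + N).bits.reverse N.bits.reverse
      simp only [hb, List.append_nil] at h1
      simp only [List.reverse_reverse, List.append_nil] at h2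
      have h12 := h1.trans h2
      simp only [Bool.toNat_true, one_mul] at h3
      rw [hhorner]
      simp only [Bool.toNat_true, one_mul]
      have := h12.trans h3
      have hstep := Within.step .main (idle false 0) (conts [] N.bits (true :: g) m.bits [] [])
        (by simpa using this)
      refine hstep.mono ?_
      simp only [List.length_cons]
      have : max (m.bits.length + 1) N.bits.length ≤ A + 1 := by omega
      have : max (2 * m + N).bits.length N.bits.length ≤ A + 2 := by omega
      nlinarith

/-- The value of the explicit threshold for the constant `128`, in the form in which the machine
computes it. -/
theorem threshold_eq (k d : ℕ) : threshold 128 k d = max (2 * k + d + 1) 16 ^ 2 := by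
  rw [threshold]
  rcases le_total (2 * k + d + 1) 16 with h | h
  · rw [max_eq_right h, max_eq_right (by nlinarith)]; rfl
  · rw [max_eq_left h, max_eq_left (by nlinarith)]

theorem bits_length_le_four_iff (n : ℕ) : n.bits.length < 5 ↔ n < 16 := by
  rw [Nat.size_eq_bits_len, Nat.lt_succ_iff, Nat.size_le]

/-- Since `2 * k + 1` has the bits `true :: k.bits`, only one addition is needed. -/
theorem addBits_threshold (k d : ℕ) :
    addBits false (true :: k.bits) d.bits = (2 * k + d + 1).bits := by
  have := bits_two_mul_add k true (fun _ => rfl)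
  rw [← this, addBits_bits]
  congr 1; simp; omega

/-- The part of the computation that determines the number to be squared. -/
theorem prepare (k d : ℕ) :
    Within (5 * (k.bits.length + d.bits.length) + 20)
      ⟨some .load, idle false 0, conts (k.bits.map .inl ++ d.bits.map .inr) [] [] [] [] []⟩
      ⟨some .restore, idle false 0, conts [] [] (max (2 * k + d + 1) 16).bits.reverse [] []
        (max (2 * k + d + 1) 16).bits.reverse⟩ := by
  have hN := addBits_threshold k d
  have hlen := length_addBits_le false (true :: k.bits) d.bits
  rw [hN] at hlen
  simp only [List.length_cons] at hlen
  have h1 := load_loop k.bits d.bits []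
  have h2 := double_loop (d.bits.map .inr) k.bits.reverse []
  have h3 := add_loop false (true :: k.bits) d.bits [] [] 0
  simp only [List.append_nil, List.reverse_reverse, List.length_reverse, hN] at h1 h2 h3
  have h123 := (h1.trans h2).trans h3
  set N := 2 * k + d + 1 with hNdef
  have hsat : satSucc^[N.bits.length] 0 = 5 ↔ 16 ≤ N := by
    rw [Fin.ext_iff, satSucc_iterate, ← not_lt (a := N), ← bits_length_le_four_iff]
    change min _ 5 = 5 ↔ _
    omega
  have hend : Within (N.bits.length + 2)
      ⟨some .check, idle false (satSucc^[N.bits.length] 0),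
        conts [] [] N.bits.reverse [] [] N.bits.reverse⟩
      ⟨some .restore, idle false 0, conts [] [] (max N 16).bits.reverse [] []
        (max N 16).bits.reverse⟩ := by
    refine Within.step _ _ _ ?_
    by_cases h : 16 ≤ N
    · rw [max_eq_left h, hsat.2 h]
      simpa using (Within.refl _).mono (Nat.zero_le _)
    · rw [max_eq_right (by omega)]
      have hs := mt hsat.1 h
      simpa [hs] using pad_loop N.bits.reverse
  refine (h123.trans hend).mono ?_
  simp only [List.length_cons]
  omega

/-- The time bound is a polynomial in the length of the input. -/
theorem run (k d : ℕ) :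
    Within (10 * (k.bits.length + d.bits.length + 7) ^ 2)
      ⟨some .load, idle false 0, conts (k.bits.map .inl ++ d.bits.map .inr) [] [] [] [] []⟩
      ⟨none, idle false 0, conts [] [] [] (threshold 128 k d).bits [] []⟩ := by
  have h1 := prepare k d
  rw [threshold_eq]
  have hlen : (max (2 * k + d + 1) 16).bits.length ≤ k.bits.length + d.bits.length + 7 := by
    rcases le_total (2 * k + d + 1) 16 with h | h
    · rw [max_eq_right h]
      have : (Nat.bits 16).length = 5 := by rw [← encodeNat_eq_bits]; rfl
      omega
    · rw [max_eq_left h]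
      have hlen := length_addBits_le false (true :: k.bits) d.bits
      rw [addBits_threshold] at hlen
      simp only [List.length_cons] at hlen
      omega
  have hN0 : max (2 * k + d + 1) 16 ≠ 0 := by omega
  generalize max (2 * k + d + 1) 16 = N at *
  have h2 := restore_loop [] N.bits.reverse [] [] N.bits.reverse
  have h3 := main_loop N hN0 N.bits.reverse 0 (fun _ b hb => by
    rw [List.head?_reverse] at hb
    exact getLast?_bits N b hb) N.bits.length (by simp)
  rw [horner_reverse_bits, ← sq] at h3
  have h4 := clear_loop N.bits (N ^ 2).bits
  simp only [List.reverse_reverse, List.append_nil, List.reverse_nil, Nat.zero_bits] at h2 h3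
  refine (((h1.trans h2).trans h3).trans h4).mono ?_
  simp only [List.length_reverse, List.length_nil]
  generalize N.bits.length = a at *
  generalize k.bits.length + d.bits.length = X at *
  have : a * (2 * (a + 2 * a) + 6) ≤ (X + 7) * (6 * (X + 7) + 6) := by
    apply Nat.mul_le_mul hlen; omega
  rw [Nat.zero_max]
  nlinarith

end Square

open Square in
theorem isPolyTime_threshold : IsPolyTime (threshold 128) := by
  refine ⟨{ tm := machine, inputAlphabet := Equiv.refl _, outputAlphabet := Equiv.refl _,
            time := 10 * (Polynomial.X + 7) ^ 2, outputsFun := fun a => ?_ }⟩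
  obtain ⟨k, d⟩ := a
  have hrun := run k d
  apply Classical.choice
  obtain ⟨m, hm, e⟩ := hrun
  have hi : initList machine (((Computability.encodingProd Computability.encodingNatBool
      Computability.encodingNatBool).encode (k, d)).map (Equiv.refl (Bool ⊕ Bool)).invFun) =
      (⟨some Label.load, idle false 0,
        conts (k.bits.map .inl ++ d.bits.map .inr) [] [] [] [] []⟩ : Conf) := by
    simp only [← encodeNat_eq_bits]
    unfold initList
    congr 1
    funext s
    cases s <;> simp [machine, conts, Computability.encodingProd, Computability.encodingNatBool]
    rfl
  have ho : haltList machine ((Computability.encodingNatBool.encode (threshold 128 k d)).map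
      (Equiv.refl Bool).invFun) =
      (⟨none, idle false 0, conts [] [] [] (threshold 128 k d).bits [] []⟩ : Conf) := by
    simp only [← encodeNat_eq_bits]
    unfold haltList
    congr 1
    funext s
    cases s <;> simp [machine, conts, Computability.encodingNatBool]
    rfl
  refine ⟨⟨⟨m, ?_⟩, hm.trans ?_⟩⟩
  · refine Eq.trans ?_ (e.trans ?_)
    · congr 2
    · exact congrArg some ho.symm
  · simp [Computability.encodingProd, Computability.encodingNatBool, encodeNat_eq_bits]

/-! ### Encoding functions and partial information about them -/

section Code

variable {n : ℕ} (σ : Encf n)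

theorem length_code (x : ℕ) : (code σ x).length = n := by simp [code]

theorem code_injective {x y : ℕ} (hx : x < 2 ^ n) (hy : y < 2 ^ n) (h : code σ x = code σ y) :
    x = y := by
  have := σ.injective (List.ofFn_injective h)
  simpa [Fin.ext_iff, Nat.mod_eq_of_lt hx, Nat.mod_eq_of_lt hy] using this

theorem exists_code_eq {u : List Bool} (hu : u.length = n) : ∃ y < 2 ^ n, code σ y = u := by
  subst hu
  refine ⟨σ.symm u.get, (σ.symm u.get).2, ?_⟩
  simp [code, Nat.mod_eq_of_lt (σ.symm u.get).2]

variable {N : ℕ}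

theorem decode_code (hN : N ≤ 2 ^ n) {x : ℕ} (hx : x < N) : decode σ N (code σ x) = some x := by
  rw [decode, List.find?_range_eq_some]
  refine ⟨by simp, by simp [hx], fun y hy => ?_⟩
  have : code σ y ≠ code σ x := fun h => hy.ne (code_injective σ (by omega) (by omega) h)
  simpa using this

theorem decode_code_of_le (hN : N ≤ 2 ^ n) {y : ℕ} (hy : N ≤ y) (hy' : y < 2 ^ n) :
    decode σ N (code σ y) = none := by
  rw [decode, List.find?_eq_none]
  intro x hx h
  have hx : x < N := List.mem_range.1 hx
  exact absurd (code_injective σ (hx.trans_le hN) hy' (beq_iff_eq.1 h)) (by omega)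

theorem decode_of_length_ne {u : List Bool} (hu : u.length ≠ n) : decode σ N u = none := by
  rw [decode, List.find?_eq_none]
  intro x _ h
  apply hu
  rw [← length_code σ x]
  simp at h
  rw [h]

end Code

/-- A piece of information `(f, u)` about an encoding function `σ` and a secret `x`: `σ (f x) = u`. -/
abbrev Entry : Type := (ℕ → ℕ) × List Bool

/-- Functions of the form `a + b * x` modulo `p`. -/
def IsAffine (p : ℕ) (f : ℕ → ℕ) : Prop := ∃ a b, f = fun x => (a + b * x) % p

/-- The functions of the secret about whose encodings a generic algorithm can learn: affine functions
modulo `p`, and constants outside of `ℤ_p`. -/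
def Admissible (n p : ℕ) (f : ℕ → ℕ) : Prop :=
  IsAffine p f ∨ ∃ y, p ≤ y ∧ y < 2 ^ n ∧ f = fun _ => y

/-- The information `h` is true of the encoding function `σ` and the secret `x`. -/
def Holds {n : ℕ} (σ : Encf n) (x : ℕ) (h : List Entry) : Prop := ∀ e ∈ h, code σ (e.1 x) = e.2

/-- Lists of entries about pairwise different strings. -/
structure Valid (n p : ℕ) (h : List Entry) : Prop where
  admissible : ∀ e ∈ h, Admissible n p e.1
  length : ∀ e ∈ h, e.2.length = n
  nodup : (h.map Prod.snd).Nodup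

open Classical in
/-- The number of pairs of an encoding function and a secret that satisfy `P` and are consistent with
the information `h`. -/
noncomputable def count (n p : ℕ) (P : Encf n → ℕ → Prop) (h : List Entry) : ℕ :=
  (((Finset.univ : Finset (Encf n)) ×ˢ Finset.range p).filter
    fun z => Holds z.1 z.2 h ∧ P z.1 z.2).card

section

variable {n p : ℕ}

theorem IsAffine.lt (hp : 0 < p) {f : ℕ → ℕ} (hf : IsAffine p f) (x : ℕ) : f x < p := by
  obtain ⟨a, b, rfl⟩ := hf
  exact Nat.mod_lt _ hp

theorem Admissible.lt (hp : 0 < p) (hpn : p ≤ 2 ^ n) {f : ℕ → ℕ} (hf : Admissible n p f) (x : ℕ) :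
    f x < 2 ^ n := by
  rcases hf with hf | ⟨y, -, hy, rfl⟩
  · exact (hf.lt hp x).trans_le hpn
  · exact hy

theorem admissible_const {y : ℕ} (hy : y < 2 ^ n) : Admissible n p fun _ => y := by
  rcases lt_or_ge y p with h | h
  · exact Or.inl ⟨y, 0, by simp [Nat.mod_eq_of_lt h]⟩
  · exact Or.inr ⟨y, h, hy, rfl⟩

theorem IsAffine.add {f g : ℕ → ℕ} (hf : IsAffine p f) (hg : IsAffine p g) :
    IsAffine p fun x => (f x + g x) % p := by
  obtain ⟨a, b, rfl⟩ := hf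
  obtain ⟨a', b', rfl⟩ := hg
  refine ⟨a + a', b + b', funext fun x => ?_⟩
  rw [← Nat.add_mod]
  congr 1; ring

theorem IsAffine.neg (hp : 0 < p) {f : ℕ → ℕ} (hf : IsAffine p f) :
    IsAffine p fun x => (p - f x) % p := by
  obtain ⟨a, b, rfl⟩ := hf
  -- `-a - b * x` is `(p - 1) * a + (p - 1) * b * x` modulo `p`
  refine ⟨(p - 1) * a, (p - 1) * b, funext fun x => ?_⟩
  have hle : (a + b * x) % p ≤ p := (Nat.mod_lt _ hp).le
  change _ ≡ _ [MOD p]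
  obtain ⟨q, rfl⟩ : ∃ q, p = q + 1 := ⟨p - 1, by omega⟩
  apply Nat.ModEq.add_right_cancel' (a + b * x)
  have h1 : (q + 1 - 1) * a + (q + 1 - 1) * b * x + (a + b * x) = (q + 1) * (a + b * x) := by
    simp; ring
  rw [h1]
  calc (q + 1 - (a + b * x) % (q + 1)) + (a + b * x)
      ≡ (q + 1 - (a + b * x) % (q + 1)) + (a + b * x) % (q + 1) [MOD q + 1] :=
        Nat.ModEq.add_left _ (Nat.mod_modEq _ _).symm
    _ = q + 1 := Nat.sub_add_cancel hle
    _ ≡ (q + 1) * (a + b * x) [MOD q + 1] := by simp [Nat.ModEq]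

/-- Over a prime field, two affine functions that agree at two places are equal. -/
theorem IsAffine.eq_of_agree (hp : p.Prime) {f g : ℕ → ℕ} (hf : IsAffine p f) (hg : IsAffine p g)
    {x y : ℕ} (hx : x < p) (hy : y < p) (hxy : x ≠ y) (hfx : f x = g x) (hfy : f y = g y) :
    f = g := by
  have := Fact.mk hp
  obtain ⟨a, b, rfl⟩ := hf
  obtain ⟨a', b', rfl⟩ := hg
  have cast : ∀ z : ℕ, (a + b * z) % p = (a' + b' * z) % p ↔
      (a : ZMod p) + b * z = a' + b' * z := by
    intro z
    have := ZMod.natCast_eq_natCast_iff (a + b * z) (a' + b' * z) p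
    push_cast at this
    exact this.symm
  have h1 := (cast x).1 hfx
  have h2 := (cast y).1 hfy
  have hne : (x : ZMod p) - y ≠ 0 := by
    rw [sub_ne_zero]
    intro h
    rw [ZMod.natCast_eq_natCast_iff] at h
    exact hxy (by rwa [Nat.ModEq, Nat.mod_eq_of_lt hx, Nat.mod_eq_of_lt hy] at h)
  have hb : (b : ZMod p) = b' := by
    apply mul_right_cancel₀ hne
    linear_combination h1 - h2
  have ha : (a : ZMod p) = a' := by
    rw [hb] at h1
    exact add_right_cancel h1
  exact funext fun z => (cast z).2 (by rw [ha, hb])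

/-- An affine function and a different admissible one agree at one secret at most. -/
theorem card_agree_le (hp : p.Prime) {f g : ℕ → ℕ} (hf : IsAffine p f) (hg : Admissible n p g)
    (hfg : f ≠ g) : ((Finset.range p).filter fun x => f x = g x).card ≤ 1 := by
  rw [Finset.card_le_one]
  intro x hx y hy
  simp only [Finset.mem_filter, Finset.mem_range] at hx hy
  by_contra hxy
  rcases hg with hg | ⟨z, hz, -, rfl⟩
  · exact hfg (hf.eq_of_agree hp hg hx.1 hy.1 hxy hx.2 hy.2)
  · have := hf.lt hp.pos x
    rw [hx.2] at this
    exact absurd this (not_lt.2 hz)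

theorem Valid.nil : Valid n p [] := ⟨by simp, by simp, by simp⟩

theorem Valid.cons {h : List Entry} (hv : Valid n p h) {f : ℕ → ℕ} {u : List Bool}
    (hf : Admissible n p f) (hu : u.length = n) (huh : u ∉ h.map Prod.snd) :
    Valid n p ((f, u) :: h) where
  admissible := by simpa using ⟨hf, fun f' u' h' => hv.admissible _ h'⟩
  length := by simpa using ⟨hu, fun f' u' h' => hv.length _ h'⟩
  nodup := by rw [List.map_cons, List.nodup_cons]; exact ⟨huh, hv.nodup⟩

theorem holds_cons {σ : Encf n} {x : ℕ} {f : ℕ → ℕ} {u : List Bool} {h : List Entry} :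
    Holds σ x ((f, u) :: h) ↔ code σ (f x) = u ∧ Holds σ x h := by
  simp [Holds]

open Classical in
/-- The number of bijections with prescribed values at `s`. -/
theorem card_equiv_eqOn {α β : Type*} [Fintype α] [Fintype β] (σ₀ : α ≃ β)
    (s : Finset α) :
    ((Finset.univ : Finset (α ≃ β)).filter fun σ => ∀ a ∈ s, σ a = σ₀ a).card =
      (Fintype.card α - s.card).factorial := by
  rw [← Fintype.card_subtype]
  have e := Equiv.Set.compl (σ₀.image (s : Set α))
  have e' : {σ : α ≃ β // ∀ a ∈ s, σ a = σ₀ a} ≃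
      {σ : α ≃ β // ∀ x : (s : Set α), σ x = σ₀.image (s : Set α) x} :=
    Equiv.subtypeEquivRight fun σ => by simp [Equiv.image]
  rw [Fintype.card_congr (e'.trans e),
    Fintype.card_equiv ((σ₀.image ((s : Set α)ᶜ)).trans (Equiv.setCongr (by
      rw [Set.image_compl_eq σ₀.bijective])))]
  congr 1
  rw [Fintype.card_compl_set]
  simp

open Classical in
theorem card_holds_le {h : List Entry} (hv : Valid n p h) (x : ℕ) :
    ((Finset.univ : Finset (Encf n)).filter fun σ => Holds σ x h).card ≤
      (2 ^ n - h.length).factorial := by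
  by_cases hex : ∃ σ₀ : Encf n, Holds σ₀ x h
  swap
  · rw [Finset.filter_eq_empty_iff.2 fun σ _ hσ => hex ⟨σ, hσ⟩]
    simp
  obtain ⟨σ₀, hσ₀⟩ := hex
  have hpos := Nat.two_pow_pos n
  let pt : ℕ → Fin (2 ^ n) := fun y => ⟨y % 2 ^ n, Nat.mod_lt _ hpos⟩
  let s : Finset (Fin (2 ^ n)) := (h.map fun e => pt (e.1 x)).toFinset
  have hs : s.card = h.length := by
    rw [List.toFinset_card_of_nodup, List.length_map]
    have hnd := hv.nodup
    have : h.map Prod.snd = (h.map fun e => pt (e.1 x)).map fun y => List.ofFn (σ₀ y) := by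
      rw [List.map_map]
      exact List.map_congr_left fun e he => (hσ₀ e he).symm
    rw [this] at hnd
    exact hnd.of_map _
  have := card_equiv_eqOn σ₀ s
  rw [hs, Fintype.card_fin] at this
  rw [← this]
  apply Finset.card_le_card
  intro σ hσ
  simp only [Finset.mem_filter, Finset.mem_univ, true_and] at hσ ⊢
  intro a ha
  simp only [s, List.mem_toFinset, List.mem_map] at ha
  obtain ⟨e, he, rfl⟩ := ha
  exact List.ofFn_injective ((hσ e he).trans (hσ₀ e he).symm)

open Classical in
theorem count_congr {P Q : Encf n → ℕ → Prop} {h : List Entry}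
    (hPQ : ∀ σ x, x < p → Holds σ x h → (P σ x ↔ Q σ x)) : count n p P h = count n p Q h := by
  unfold count
  congr 1
  apply Finset.filter_congr
  intro z hz
  simp only [Finset.mem_product, Finset.mem_range] at hz
  exact and_congr_right fun hh => hPQ _ _ hz.2 hh

/-- If only secrets in `X` satisfy `P`, the count is at most `#X` times the number of encoding
functions that are consistent with the information. -/
theorem count_le_card_mul {P : Encf n → ℕ → Prop} {h : List Entry}
    (hv : Valid n p h) (X : Finset ℕ) (hX : ∀ σ x, x < p → Holds σ x h → P σ x → x ∈ X) :
    count n p P h ≤ X.card * (2 ^ n - h.length).factorial := by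
  classical
  unfold count
  calc _ ≤ (X.biUnion fun x => ((Finset.univ : Finset (Encf n)).filter fun σ =>
          Holds σ x h).image fun σ => (σ, x)).card := by
        apply Finset.card_le_card
        rintro ⟨σ, x⟩ hz
        simp only [Finset.mem_filter, Finset.mem_product, Finset.mem_range, Finset.mem_univ,
          true_and] at hz
        simp only [Finset.mem_biUnion, Finset.mem_image, Finset.mem_filter, Finset.mem_univ,
          true_and]
        exact ⟨x, hX σ x hz.1 hz.2.1 hz.2.2, σ, hz.2.1, rfl⟩
    _ ≤ X.card * (2 ^ n - h.length).factorial := by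
        apply Finset.card_biUnion_le_card_mul
        intro x _
        exact Finset.card_image_le.trans (card_holds_le hv x)

theorem mul_factorial_sub (a m : ℕ) :
    (a - m) * (a - (m + 1)).factorial ≤ (a - m).factorial := by
  rcases Nat.eq_zero_or_pos (a - m) with h | h
  · simp [h]
  · have : a - (m + 1) = a - m - 1 := by omega
    rw [this, Nat.mul_factorial_pred h.ne']

/-- Asking for the preimage of a string: it is an unknown element of `{0, …, 2 ^ n - 1}`.  The loss of
`2 * m` accounts for the values that are excluded by the information already there. -/
theorem count_le_of_preimage {P : Encf n → ℕ → Prop} {h : List Entry}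
    (hv : Valid n p h) (hm : p ≤ 2 * (2 ^ n - h.length)) (u : List Bool) (K : ℕ)
    (hK : ∀ h', Valid n p h' → h ⊆ h' → h'.length ≤ h.length + 1 →
      (u.length = n → ∃ f, (f, u) ∈ h') →
      count n p P h' ≤ K * (2 ^ n - h'.length).factorial) :
    count n p P h ≤ (K + 2 * h.length) * (2 ^ n - h.length).factorial := by
  classical
  by_cases hknown : u.length = n ∧ u ∉ h.map Prod.snd
  swap
  · refine (hK h hv (List.Subset.refl _) (by omega) fun hu => ?_).trans
      (Nat.mul_le_mul_right _ (by omega))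
    have : u ∈ h.map Prod.snd := by
      by_contra hc; exact hknown ⟨hu, hc⟩
    obtain ⟨⟨f, u'⟩, he, rfl⟩ := List.mem_map.1 this
    exact ⟨f, he⟩
  obtain ⟨hu, huh⟩ := hknown
  set F := (2 ^ n - (h.length + 1)).factorial with hF
  have hbound : ∀ y < 2 ^ n, count n p P (((fun _ => y), u) :: h) ≤ min K p * F := by
    intro y hy
    have hv' := hv.cons (admissible_const (p := p) hy) hu huh
    rw [Nat.mul_comm, Nat.mul_min_mul_left F K p |>.symm, Nat.mul_comm F K, Nat.mul_comm F p]
    refine le_min ?_ ?_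
    · exact hK _ hv' (List.subset_cons_self _ _) (by simp) fun _ => ⟨_, List.mem_cons_self⟩
    · have := count_le_card_mul (P := P) hv' (Finset.range p)
        fun σ x hx _ _ => Finset.mem_range.2 hx
      simpa [hF] using this
  have hsum : count n p P h ≤ 2 ^ n * (min K p * F) := by
    conv_lhs => unfold count
    calc _ ≤ ((Finset.range (2 ^ n)).biUnion fun y =>
            ((Finset.univ : Finset (Encf n)) ×ˢ Finset.range p).filter fun z =>
              Holds z.1 z.2 (((fun _ => y), u) :: h) ∧ P z.1 z.2).card := by
          apply Finset.card_le_card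
          intro z hz
          simp only [Finset.mem_filter] at hz
          obtain ⟨y, hy, hyu⟩ := exists_code_eq z.1 hu
          simp only [Finset.mem_biUnion, Finset.mem_filter, Finset.mem_range, holds_cons]
          exact ⟨y, hy, hz.1, ⟨hyu, hz.2.1⟩, hz.2.2⟩
      _ ≤ (Finset.range (2 ^ n)).card * (min K p * F) := by
          apply Finset.card_biUnion_le_card_mul
          intro y hy
          exact hbound y (Finset.mem_range.1 hy)
      _ = _ := by rw [Finset.card_range]
  refine hsum.trans ?_
  have hfac := mul_factorial_sub (2 ^ n) h.length
  rw [← hF] at hfac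
  set D := 2 ^ n - h.length with hD
  have h2 : 2 ^ n ≤ D + h.length := by omega
  calc 2 ^ n * (min K p * F) ≤ (D + h.length) * (min K p * F) := Nat.mul_le_mul_right _ h2
    _ = D * (min K p * F) + h.length * (min K p * F) := by ring
    _ ≤ D * (K * F) + h.length * ((2 * D) * F) := by
        gcongr
        · exact min_le_left _ _
        · exact (min_le_right _ _).trans hm
    _ = (K + 2 * h.length) * (D * F) := by ring
    _ ≤ _ := Nat.mul_le_mul_left _ hfac

open Classical in
/-- The strings of length `n` about which there is no information. -/
noncomputable def freshStrings (n : ℕ) (h : List Entry) : Finset (List Bool) :=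
  ((Finset.univ : Finset (Fin n → Bool)).image List.ofFn) \ (h.map Prod.snd).toFinset

theorem mem_freshStrings {h : List Entry} {u : List Bool} :
    u ∈ freshStrings n h ↔ u.length = n ∧ u ∉ h.map Prod.snd := by
  classical
  simp only [freshStrings, Finset.mem_sdiff, Finset.mem_image, Finset.mem_univ, true_and,
    List.mem_toFinset]
  refine and_congr_left fun _ => ⟨?_, ?_⟩
  · rintro ⟨a, rfl⟩; simp
  · rintro rfl; exact ⟨u.get, List.ofFn_get u⟩

theorem card_freshStrings {h : List Entry} (hv : Valid n p h) :
    (freshStrings n h).card = 2 ^ n - h.length := by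
  classical
  rw [freshStrings, Finset.card_sdiff_of_subset, Finset.card_image_of_injective _
    List.ofFn_injective, List.toFinset_card_of_nodup hv.nodup]
  · simp
  · intro u hu
    obtain ⟨e, he, rfl⟩ := List.mem_map.1 (List.mem_toFinset.1 hu)
    have := hv.length e he
    subst this
    exact Finset.mem_image.2 ⟨e.2.get, Finset.mem_univ _, List.ofFn_get _⟩

/-- Asking for the encoding of an affine function `f` of the secret.  Unless `f x` collides with one of
the `m` known elements, which happens for at most `m` secrets, the answer is a fresh string. -/
theorem count_le_of_image (hp : p.Prime) (hpn : p ≤ 2 ^ n) {P : Encf n → ℕ → Prop} {h : List Entry}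
    (hv : Valid n p h) {f : ℕ → ℕ} (hf : IsAffine p f) (K : ℕ)
    (hK : ∀ h', Valid n p h' → h ⊆ h' → h'.length ≤ h.length + 1 → (∃ u, (f, u) ∈ h') →
      count n p P h' ≤ K * (2 ^ n - h'.length).factorial) :
    count n p P h ≤ (K + h.length) * (2 ^ n - h.length).factorial := by
  classical
  by_cases hknown : ∃ u, (f, u) ∈ h
  · exact (hK h hv (List.Subset.refl _) (by omega) hknown).trans
      (Nat.mul_le_mul_right _ (by omega))
  set F := (2 ^ n - (h.length + 1)).factorial with hF
  set bad : Encf n → ℕ → Prop := fun σ x => P σ x ∧ code σ (f x) ∈ h.map Prod.snd with hbad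
  let X : Finset ℕ := h.toFinset.biUnion fun e => (Finset.range p).filter fun x => f x = e.1 x
  have hXcard : X.card ≤ h.length := by
    calc X.card ≤ h.toFinset.card * 1 := by
          apply Finset.card_biUnion_le_card_mul
          intro e he
          refine card_agree_le hp hf (hv.admissible e (List.mem_toFinset.1 he)) ?_
          rintro rfl
          exact hknown ⟨e.2, List.mem_toFinset.1 he⟩
      _ ≤ h.length := by rw [mul_one]; exact List.toFinset_card_le h
  have hbadcount : count n p bad h ≤ h.length * (2 ^ n - h.length).factorial := by
    refine (count_le_card_mul hv X ?_).trans (Nat.mul_le_mul_right _ hXcard)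
    rintro σ x hx hh ⟨-, hc⟩
    obtain ⟨e, he, hec⟩ := List.mem_map.1 hc
    simp only [X, Finset.mem_biUnion, List.mem_toFinset, Finset.mem_filter, Finset.mem_range]
    refine ⟨e, he, hx, code_injective σ ((hf.lt hp.pos x).trans_le hpn)
      ((hv.admissible e he).lt hp.pos hpn x) ?_⟩
    rw [hh e he, hec]
  have hsum : count n p P h ≤ (freshStrings n h).card * (K * F) + count n p bad h := by
    conv_lhs => unfold count
    calc _ ≤ (((freshStrings n h).biUnion fun u =>
            ((Finset.univ : Finset (Encf n)) ×ˢ Finset.range p).filter fun z =>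
              Holds z.1 z.2 ((f, u) :: h) ∧ P z.1 z.2) ∪
            ((Finset.univ : Finset (Encf n)) ×ˢ Finset.range p).filter fun z =>
              Holds z.1 z.2 h ∧ bad z.1 z.2).card := by
          apply Finset.card_le_card
          intro z hz
          simp only [Finset.mem_filter] at hz
          simp only [Finset.mem_union, Finset.mem_biUnion, Finset.mem_filter, holds_cons]
          by_cases hc : code z.1 (f z.2) ∈ h.map Prod.snd
          · exact Or.inr ⟨hz.1, hz.2.1, hz.2.2, hc⟩
          · exact Or.inl ⟨_, mem_freshStrings.2 ⟨length_code _ _, hc⟩, hz.1, ⟨rfl, hz.2.1⟩, hz.2.2⟩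
      _ ≤ _ := by
          refine (Finset.card_union_le _ _).trans (Nat.add_le_add ?_
            (le_of_eq (by unfold count; congr)))
          apply Finset.card_biUnion_le_card_mul
          intro u hu
          obtain ⟨hu, huh⟩ := mem_freshStrings.1 hu
          have := hK _ (hv.cons (Or.inl hf) hu huh) (List.subset_cons_self _ _) (by simp)
            ⟨u, List.mem_cons_self⟩
          exact this
  rw [card_freshStrings hv] at hsum
  have hfac := mul_factorial_sub (2 ^ n) h.length
  rw [← hF] at hfac
  calc _ ≤ _ := hsum
    _ = K * ((2 ^ n - h.length) * F) + count n p bad h := by ring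
    _ ≤ K * (2 ^ n - h.length).factorial + h.length * (2 ^ n - h.length).factorial := by gcongr
    _ = _ := by ring

end
/-! ### The generic algorithm against a random encoding function -/

section

variable {n p : ℕ}

theorem decode_of_affine (hp : 0 < p) (hpn : p ≤ 2 ^ n) {σ : Encf n} {x : ℕ} {h : List Entry}
    (hh : Holds σ x h) {f : ℕ → ℕ} {u : List Bool} (hf : IsAffine p f) (hfu : (f, u) ∈ h) :
    decode σ p u = some (f x) := by
  rw [← show code σ (f x) = u from hh _ hfu]
  exact decode_code σ hpn (hf.lt hp x)

theorem decode_of_not_affine (hpn : p ≤ 2 ^ n) {σ : Encf n} {x : ℕ} {h : List Entry}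
    (hh : Holds σ x h) (hv : Valid n p h) {f : ℕ → ℕ} {u : List Bool} (hf : ¬ IsAffine p f)
    (hfu : (f, u) ∈ h) : decode σ p u = none := by
  rw [← show code σ (f x) = u from hh _ hfu]
  rcases hv.admissible _ hfu with h' | ⟨y, hy, hy', rfl⟩
  · exact absurd h' hf
  · exact decode_code_of_le σ hpn hy hy'

/-- Once it is known whether `u` is in the group, either `u` is a known affine function of the secret
or it is certainly outside of the group. -/
theorem affine_or_decode_eq_none (hpn : p ≤ 2 ^ n) {h : List Entry} (hv : Valid n p h)
    {u : List Bool} (hu : u.length = n → ∃ f, (f, u) ∈ h) :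
    (∃ f, IsAffine p f ∧ (f, u) ∈ h) ∨
      ∀ (σ : Encf n) (x : ℕ), Holds σ x h → decode σ p u = none := by
  by_cases hlen : u.length = n
  · obtain ⟨f, hfu⟩ := hu hlen
    by_cases hf : IsAffine p f
    · exact Or.inl ⟨f, hf, hfu⟩
    · exact Or.inr fun σ x hh => decode_of_not_affine hpn hh hv hf hfu
  · exact Or.inr fun σ x _ => decode_of_length_ne σ hlen

/-- A query to the oracle `add` reveals at most three entries: what its arguments encode, and the
answer.  If the count is bounded for every fixed answer, it is bounded in general. -/
theorem count_le_of_add (hp : p.Prime) (hpn : p ≤ 2 ^ n) {h : List Entry} (hv : Valid n p h)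
    (hm : p ≤ 2 * (2 ^ n - (h.length + 1))) (u v : List Bool)
    (P : List Bool → Encf n → ℕ → Prop) (K : ℕ)
    (hK : ∀ w h', Valid n p h' → h'.length ≤ h.length + 3 →
      count n p (P w) h' ≤ K * (2 ^ n - h'.length).factorial) :
    count n p (fun σ x => P ((groupOracle σ p).add u v) σ x) h ≤
      (K + (5 * h.length + 4)) * (2 ^ n - h.length).factorial := by
  have fixed : ∀ w h', Valid n p h' → h'.length ≤ h.length + 3 →
      (∀ (σ : Encf n) (x : ℕ), x < p → Holds σ x h' → (groupOracle σ p).add u v = w) →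
      count n p (fun σ x => P ((groupOracle σ p).add u v) σ x) h' ≤
        K * (2 ^ n - h'.length).factorial := by
    intro w h' hv' hlen hw
    rw [count_congr (Q := P w) fun σ x hx hh => by rw [hw σ x hx hh]]
    exact hK w h' hv' hlen
  -- the losses are `2 * m` and `2 * (m + 1)` for the arguments, and `m + 2` for the answer
  have hC := count_le_of_preimage (P := fun σ x => P ((groupOracle σ p).add u v) σ x) hv
    (by omega) u (K + (h.length + 2) + 2 * (h.length + 1)) ?_
  · refine hC.trans (Nat.mul_le_mul_right _ (by omega))
  intro h₁ hv₁ hs₁ hlen₁ hu₁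
  refine (count_le_of_preimage hv₁ (by omega) v (K + (h.length + 2)) ?_).trans
    (Nat.mul_le_mul_right _ (by omega))
  intro h₂ hv₂ hs₂ hlen₂ hv₂'
  have hu₂ : u.length = n → ∃ f, (f, u) ∈ h₂ := fun hl =>
    let ⟨f, hf⟩ := hu₁ hl; ⟨f, hs₂ hf⟩
  have weaken : ∀ w, (∀ (σ : Encf n) (x : ℕ), x < p → Holds σ x h₂ →
      (groupOracle σ p).add u v = w) →
      count n p (fun σ x => P ((groupOracle σ p).add u v) σ x) h₂ ≤
        (K + (h.length + 2)) * (2 ^ n - h₂.length).factorial := fun w hw =>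
    (fixed w h₂ hv₂ (by omega) hw).trans (Nat.mul_le_mul_right _ (by omega))
  rcases affine_or_decode_eq_none hpn hv₂ hu₂ with ⟨f, hf, hfu⟩ | hnone
  swap
  · exact weaken [] fun σ x _ hh => by simp [groupOracle, hnone σ x hh]
  rcases affine_or_decode_eq_none hpn hv₂ hv₂' with ⟨g, hg, hgv⟩ | hnone
  swap
  · exact weaken [] fun σ x _ hh => by simp [groupOracle, hnone σ x hh]
  refine (count_le_of_image hp hpn hv₂ (hf.add hg) K ?_).trans
    (Nat.mul_le_mul_right _ (by omega))
  rintro h₃ hv₃ hs₃ hlen₃ ⟨w, hw⟩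
  refine fixed w h₃ hv₃ (by omega) fun σ x hx hh => ?_
  have h1 := decode_of_affine hp.pos hpn hh hf (hs₃ hfu)
  have h2 := decode_of_affine hp.pos hpn hh hg (hs₃ hgv)
  simpa [groupOracle, h1, h2] using hh _ hw

/-- A query to the oracle `inv` reveals at most two entries. -/
theorem count_le_of_inv (hp : p.Prime) (hpn : p ≤ 2 ^ n) {h : List Entry} (hv : Valid n p h)
    (hm : p ≤ 2 * (2 ^ n - h.length)) (u : List Bool)
    (P : List Bool → Encf n → ℕ → Prop) (K : ℕ)
    (hK : ∀ w h', Valid n p h' → h'.length ≤ h.length + 2 →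
      count n p (P w) h' ≤ K * (2 ^ n - h'.length).factorial) :
    count n p (fun σ x => P ((groupOracle σ p).inv u) σ x) h ≤
      (K + (3 * h.length + 1)) * (2 ^ n - h.length).factorial := by
  have fixed : ∀ w h', Valid n p h' → h'.length ≤ h.length + 2 →
      (∀ (σ : Encf n) (x : ℕ), x < p → Holds σ x h' → (groupOracle σ p).inv u = w) →
      count n p (fun σ x => P ((groupOracle σ p).inv u) σ x) h' ≤
        K * (2 ^ n - h'.length).factorial := by
    intro w h' hv' hlen hw
    rw [count_congr (Q := P w) fun σ x hx hh => by rw [hw σ x hx hh]]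
    exact hK w h' hv' hlen
  have hC := count_le_of_preimage (P := fun σ x => P ((groupOracle σ p).inv u) σ x) hv hm u
    (K + (h.length + 1)) ?_
  · refine hC.trans (Nat.mul_le_mul_right _ (by omega))
  intro h₁ hv₁ hs₁ hlen₁ hu₁
  rcases affine_or_decode_eq_none hpn hv₁ hu₁ with ⟨f, hf, hfu⟩ | hnone
  swap
  · refine (fixed [] h₁ hv₁ (by omega) fun σ x _ hh => ?_).trans
      (Nat.mul_le_mul_right _ (by omega))
    simp [groupOracle, hnone σ x hh]
  refine (count_le_of_image hp hpn hv₁ (hf.neg hp.pos) K ?_).trans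
    (Nat.mul_le_mul_right _ (by omega))
  rintro h₂ hv₂ hs₂ hlen₂ ⟨w, hw⟩
  refine fixed w h₂ hv₂ (by omega) fun σ x hx hh => ?_
  have h1 := decode_of_affine hp.pos hpn hh hf (hs₂ hfu)
  simpa [groupOracle, h1] using hh _ hw

/-- A step of a machine consults the oracles at most once, about strings that do not depend on the
oracles. -/
theorem step_cases (m : Machine) (c : Config) (b : Bool) :
    (∃ c', ∀ O, m.step O c b = c') ∨
    (∃ u v, ∃ next : List Bool → Config, ∀ O, m.step O c b = next (O.add u v)) ∨
    ∃ u, ∃ next : List Bool → Config, ∀ O, m.step O c b = next (O.inv u) := by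
  cases hr : m.rules.find? fun r => r.state == c.state && r.coin == b && r.reads == m.scan c with
  | none => exact Or.inl ⟨c, fun O => by simp only [Machine.step, hr]⟩
  | some r =>
    cases hcall : r.call with
    | none => exact Or.inl ⟨⟨r.next, Machine.act r c.tapes⟩, fun O => by
        simp only [Machine.step, hr, hcall, Machine.query]⟩
    | add => exact Or.inr <| Or.inl ⟨(Machine.act r c.tapes 1).bits, (Machine.act r c.tapes 2).bits,
        fun w => ⟨r.next, Function.update (Machine.act r c.tapes) 3 (Tape.ofWord (symbols w))⟩,
        fun O => by simp only [Machine.step, hr, hcall, Machine.query]⟩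
    | inv => exact Or.inr <| Or.inr ⟨(Machine.act r c.tapes 1).bits,
        fun w => ⟨r.next, Function.update (Machine.act r c.tapes) 3 (Tape.ofWord (symbols w))⟩,
        fun O => by simp only [Machine.step, hr, hcall, Machine.query]⟩

/-- The number of pairs of an encoding function and a secret for which a computation of `T` steps finds
the secret, given `m` entries of information at its start, is at most
`(1 + 6 * T * (m + 3 * T)) * (2 ^ n - m)!`. -/
theorem count_run_le (hp : p.Prime) (hpn : p ≤ 2 ^ n) (m : Machine) (coins : List Bool) (c : Config)
    {h : List Entry} (hv : Valid n p h) (hm : p ≤ 2 * (2 ^ n - (h.length + 3 * coins.length))) :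
    count n p (fun σ x =>
        value ((coins.foldl (m.step (groupOracle σ p)) c).tapes 4).bits = x) h ≤
      (1 + 6 * coins.length * (h.length + 3 * coins.length)) *
        (2 ^ n - h.length).factorial := by
  induction coins generalizing c h with
  | nil =>
    -- the output is fixed, so at most one secret agrees with it
    refine (count_le_card_mul hv {value ((c.tapes 4).bits)} ?_).trans (by simp)
    intro σ x _ _ hx
    simpa using hx.symm
  | cons b coins ih =>
    simp only [List.length_cons] at hm ⊢
    simp only [List.foldl_cons]
    set T := coins.length with hT
    -- a step adds at most three entries, at a loss of at most `5 * m + 4`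
    have hbound : ∀ (c' : Config) (h' : List Entry), Valid n p h' → h'.length ≤ h.length + 3 →
        count n p (fun σ x =>
            value ((coins.foldl (m.step (groupOracle σ p)) c').tapes 4).bits = x) h' ≤
          (1 + 6 * T * (h.length + 3 * T + 3)) * (2 ^ n - h'.length).factorial := by
      intro c' h' hv' hlen
      refine (ih c' hv' (by omega)).trans (Nat.mul_le_mul_right _ ?_)
      have : h'.length + 3 * T ≤ h.length + 3 * T + 3 := by omega
      gcongr
    have hfinal : ∀ a, a ≤ 5 * h.length + 4 →
        (1 + 6 * T * (h.length + 3 * T + 3)) + a ≤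
          1 + 6 * (T + 1) * (h.length + 3 * (T + 1)) := by
      intro a ha; nlinarith
    rcases step_cases m c b with ⟨c', hc'⟩ | ⟨u, v, next, hnext⟩ | ⟨u, next, hnext⟩
    · simp only [hc']
      exact (hbound c' h hv (by omega)).trans (Nat.mul_le_mul_right _ (hfinal 0 (by omega)))
    · simp only [hnext]
      refine (count_le_of_add hp hpn hv (by omega) u v (fun w σ x =>
        value ((coins.foldl (m.step (groupOracle σ p)) (next w)).tapes 4).bits = x) _
        fun w h' hv' hlen => hbound (next w) h' hv' hlen).trans
        (Nat.mul_le_mul_right _ (hfinal _ le_rfl))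
    · simp only [hnext]
      refine (count_le_of_inv hp hpn hv (by omega) u (fun w σ x =>
        value ((coins.foldl (m.step (groupOracle σ p)) (next w)).tapes 4).bits = x) _
        fun w h' hv' hlen => hbound (next w) h' hv' (by omega)).trans
        (Nat.mul_le_mul_right _ (hfinal _ (by omega)))

/-- The bound for a computation that starts from the encodings of `1` and the secret. -/
theorem count_output_le (hp : p.Prime) (hpn : p ≤ 2 ^ n) (m : Machine) (coins : List Bool)
    (hm : p ≤ 2 * (2 ^ n - (2 + 3 * coins.length))) :
    count n p (fun σ x => value (m.output (groupOracle σ p)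
        (inputWord p [code σ 1, code σ x]) coins) = x) [] ≤
      (2 + 6 * coins.length * (2 + 3 * coins.length)) * (2 ^ n).factorial := by
  set T := coins.length with hT
  set P : Encf n → ℕ → Prop := fun σ x => value (m.output (groupOracle σ p)
        (inputWord p [code σ 1, code σ x]) coins) = x
  have hone : IsAffine p fun _ => 1 := ⟨1, 0, by simp [Nat.mod_eq_of_lt hp.one_lt]⟩
  have hid : IsAffine p fun x => x % p := ⟨0, 1, by simp⟩
  refine (count_le_of_image hp hpn Valid.nil hone (2 + 6 * T * (2 + 3 * T)) ?_).trans (by simp)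
  rintro h₁ hv₁ - hlen₁ ⟨u, hu⟩
  refine (count_le_of_image hp hpn hv₁ hid (1 + 6 * T * (2 + 3 * T)) ?_).trans
    (Nat.mul_le_mul_right _ (by simp at hlen₁; omega))
  rintro h₂ hv₂ hs₂ hlen₂ ⟨v, hv⟩
  have hlen : h₂.length ≤ 2 := by simp at hlen₁; omega
  rw [count_congr (Q := fun σ x => value ((coins.foldl (m.step (groupOracle σ p))
    (Machine.init (inputWord p [u, v]))).tapes 4).bits = x)]
  -- the input word is now known
  · refine (count_run_le hp hpn m coins _ hv₂ (by omega)).trans (Nat.mul_le_mul_right _ ?_)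
    gcongr
  · intro σ x hx hh
    have h1 := hh _ (hs₂ hu)
    have h2 := hh _ hv
    simp only [Nat.mod_eq_of_lt hx] at h1 h2
    simp only [P, Machine.output, h1, h2]

end
/-! ### The size of the bound -/

theorem sixteen_mul_sq_le_two_pow {r : ℕ} (hr : 16 ≤ r) : 16 * (r + 1) ^ 2 ≤ 2 ^ r := by
  induction r, hr using Nat.le_induction with
  | base => norm_num
  | succ r hr ih => rw [pow_succ 2]; nlinarith

/-- From the threshold on, the bound for the running time of the `k`-th algorithm is small enough. -/
theorem bound_mul_pow_le {k d n : ℕ} (hk : 1 ≤ k) (h : threshold 128 k d ≤ n) :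
    (2 + 6 * ((4 * n + 4) ^ k + k) * (2 + 3 * ((4 * n + 4) ^ k + k))) * n ^ d ≤ 2 ^ (n - 1) := by
  obtain ⟨h1, h2⟩ := max_le_iff.1 h
  set r := Nat.sqrt n with hr
  have hr16 : 16 ≤ r := Nat.le_sqrt'.2 (by omega)
  have hsr : 2 * k + d + 1 ≤ r := Nat.le_sqrt'.2 h1
  have hn : 16 * n ≤ 2 ^ r := by
    have h3 : n < (r + 1) ^ 2 := Nat.lt_succ_sqrt' n
    have := sixteen_mul_sq_le_two_pow hr16
    omega
  set T := (4 * n + 4) ^ k + k with hT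
  have hT1 : 1 ≤ T := by omega
  have hT2 : T ≤ 2 * (8 * n) ^ k := by
    have h3 : (4 * n + 4) ^ k ≤ (8 * n) ^ k := Nat.pow_le_pow_left (by omega) k
    have h4 : k < (8 * n) ^ k := Nat.lt_pow_self (by omega)
    omega
  have h5 : 2 * ((2 + 6 * T * (2 + 3 * T)) * n ^ d) ≤ 2 ^ n := by
    calc 2 * ((2 + 6 * T * (2 + 3 * T)) * n ^ d) ≤ 2 * ((32 * T ^ 2) * n ^ d) := by
          gcongr; nlinarith
      _ ≤ 2 * ((32 * (2 * (8 * n) ^ k) ^ 2) * n ^ d) := by gcongr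
      _ = 2 ^ 8 * (64 ^ k * n ^ (2 * k + d)) := by
          rw [mul_pow, mul_pow, mul_pow, ← pow_mul, ← pow_mul, pow_add, mul_comm k 2, pow_mul 8]
          norm_num; ring
      _ ≤ 2 ^ 8 * (16 ^ (2 * k + d) * n ^ (2 * k + d)) := by
          refine Nat.mul_le_mul_left _ (Nat.mul_le_mul_right _ ?_)
          calc 64 ^ k ≤ 256 ^ k := Nat.pow_le_pow_left (by norm_num) k
            _ = 16 ^ (2 * k) := by rw [pow_mul]; norm_num
            _ ≤ 16 ^ (2 * k + d) := Nat.pow_le_pow_right (by norm_num) (by omega)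
      _ = 2 ^ 8 * (16 * n) ^ (2 * k + d) := by rw [mul_pow]
      _ ≤ 2 ^ 8 * (2 ^ r) ^ (r - 1) := by
          have hpos : 0 < 2 ^ r := Nat.two_pow_pos r
          refine Nat.mul_le_mul_left _ ?_
          calc (16 * n) ^ (2 * k + d) ≤ (2 ^ r) ^ (2 * k + d) := Nat.pow_le_pow_left hn _
            _ ≤ (2 ^ r) ^ (r - 1) := Nat.pow_le_pow_right hpos (by omega)
      _ = 2 ^ (8 + r * (r - 1)) := by rw [pow_add, pow_mul]
      _ ≤ 2 ^ n := by
          apply Nat.pow_le_pow_right (by norm_num)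
          have h6 : r * r ≤ n := Nat.sqrt_le n
          obtain ⟨t, ht⟩ : ∃ t, r = t + 1 := ⟨r - 1, by omega⟩
          rw [ht] at h6 ⊢
          simp only [Nat.add_sub_cancel]
          nlinarith
  have h7 : 2 ^ n = 2 * 2 ^ (n - 1) := by
    rw [← pow_succ', Nat.sub_add_cancel (by omega)]
  omega

/-! ### The experiment -/

theorem mem_nBitPrimes {n p : ℕ} :
    p ∈ nBitPrimes n ↔ 2 ^ (n - 1) ≤ p ∧ p < 2 ^ n ∧ p.Prime := by
  simp [nBitPrimes, and_assoc]

theorem length_binary {n p : ℕ} (hn : 1 ≤ n) (hp : p ∈ nBitPrimes n) : (binary p).length = n := by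
  obtain ⟨h1, h2, -⟩ := mem_nBitPrimes.1 hp
  rw [binary, List.length_reverse, Nat.size_eq_bits_len]
  apply le_antisymm (Nat.size_le.2 h2)
  have := Nat.lt_size.2 h1
  omega

theorem length_inputWord {n p : ℕ} (hn : 1 ≤ n) (hp : p ∈ nBitPrimes n) (σ : Encf n) (x y : ℕ) :
    (inputWord p [code σ x, code σ y]).length = 4 * n + 4 := by
  rw [inputWord, Nat.primeFactorsList_prime (mem_nBitPrimes.1 hp).2.2]
  simp [symbols, length_code, length_binary hn hp]
  omega

/-- All inputs for the same `n` have the same length, so the number of coin tosses is fixed. -/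
theorem successProb_eq (M : ℕ → Machine) (k : ℕ) {n : ℕ} (σ : Encf n) (p x : ℕ) (T : ℕ)
    (hT : clock k (inputWord p [code σ 1, code σ x]) = T) :
    successProb M k σ p x = 𝔼 coins : Fin T → Bool,
      if value ((M k).output (groupOracle σ p) (inputWord p [code σ 1, code σ x])
        (List.ofFn coins)) = x then (1 : ℝ) else 0 := by
  subst hT
  rfl

theorem expect_le_of_forall_le {ι : Type*} (s : Finset ι) (f : ι → ℝ) {a : ℝ} (ha : 0 ≤ a)
    (h : ∀ i ∈ s, f i ≤ a) : 𝔼 i ∈ s, f i ≤ a := by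
  rcases s.eq_empty_or_nonempty with rfl | hs
  · simpa using ha
  · exact Finset.expect_le hs h

open Classical in
theorem expect_expect_eq_count {n p : ℕ} (P : Encf n → ℕ → Prop) :
    (𝔼 σ : Encf n, 𝔼 x ∈ Finset.range p, if P σ x then (1 : ℝ) else 0) =
      count n p P [] / ((2 ^ n).factorial * p) := by
  have hcard : Fintype.card (Encf n) = (2 ^ n).factorial := by
    rw [Fintype.card_equiv (Fintype.equivOfCardEq (by simp)), Fintype.card_fin]
  simp only [Finset.expect_eq_sum_div_card, Finset.card_range, Finset.card_univ, hcard]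
  rw [← Finset.sum_div, div_div, mul_comm (p : ℝ), ← Finset.sum_product', Finset.sum_boole, count]
  simp [Holds]

/-- The average success probability is at most `1 / n ^ d` from the explicit threshold on. -/
theorem expect_dlogProb_le (M : ℕ → Machine) {k d n : ℕ} (hk : 1 ≤ k)
    (h : threshold 128 k d ≤ n) : (𝔼 σ : Encf n, dlogProb M k σ) ≤ 1 / (n : ℝ) ^ d := by
  have hn : 256 ≤ n := (le_max_right _ _).trans h
  have hnd : 0 ≤ 1 / (n : ℝ) ^ d := by positivity
  have hbound := bound_mul_pow_le hk h
  set T := (4 * n + 4) ^ k + k with hT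
  unfold dlogProb
  rw [Finset.expect_comm]
  refine expect_le_of_forall_le _ _ hnd fun p hp => ?_
  obtain ⟨hp1, hp2, hpp⟩ := mem_nBitPrimes.1 hp
  have hclock : ∀ (σ : Encf n) (x : ℕ), clock k (inputWord p [code σ 1, code σ x]) = T :=
    fun σ x => by rw [clock, length_inputWord (by omega) hp]
  simp only [successProb_eq M k _ p _ T (hclock _ _)]
  simp only [Finset.expect_comm (s := Finset.range p)]
  rw [Finset.expect_comm]
  refine expect_le_of_forall_le _ _ hnd fun coins _ => ?_
  have hnd1 : 1 ≤ n ^ d := Nat.one_le_pow _ _ (by omega)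
  have h2n : 2 ^ n = 2 * 2 ^ (n - 1) := by
    rw [← pow_succ', Nat.sub_add_cancel (by omega)]
  have hroom : p ≤ 2 * (2 ^ n - (2 + 3 * (List.ofFn coins).length)) := by
    rw [List.length_ofFn]
    have : 2 + 6 * T * (2 + 3 * T) ≤ 2 ^ (n - 1) := by nlinarith
    have : 3 * T ≤ 6 * T * (2 + 3 * T) := by nlinarith
    omega
  have hcount := count_output_le hpp hp2.le (M k) (List.ofFn coins) hroom
  rw [List.length_ofFn] at hcount
  set P : Encf n → ℕ → Prop := fun σ x => value ((M k).output (groupOracle σ p)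
    (inputWord p [code σ 1, code σ x]) (List.ofFn coins)) = x with hP
  have heq := expect_expect_eq_count (p := p) P
  have hfac : (0 : ℝ) < (2 ^ n).factorial := by exact_mod_cast Nat.factorial_pos _
  have hp0 : (0 : ℝ) < p := by exact_mod_cast hpp.pos
  have hn0 : (0 : ℝ) < (n : ℝ) ^ d := by exact_mod_cast hnd1
  calc _ = (count n p P [] : ℝ) / ((2 ^ n).factorial * p) := by
        rw [← heq]
        refine Finset.expect_congr rfl fun σ _ => Finset.expect_congr rfl fun x _ => ?_
        simp only [hP]
    _ ≤ 1 / (n : ℝ) ^ d := by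
        rw [div_le_div_iff₀ (by positivity) hn0]
        have hnat : count n p P [] * n ^ d ≤ 1 * ((2 ^ n).factorial * p) := by
          rw [one_mul]
          refine (Nat.mul_le_mul_right _ hcount).trans ?_
          rw [mul_right_comm, mul_comm]
          exact Nat.mul_le_mul_left _ (hbound.trans hp1)
        exact_mod_cast hnat

/-! ### Computability -/

theorem exists_isRecursiveEnumeration : ∃ M : ℕ → Machine, IsRecursiveEnumeration M := by
  refine ⟨fun k => (Encodable.decode (α := Machine) (k - 1)).getD ⟨0, []⟩, ?_, fun m => ?_⟩
  · exact Computable.option_getD (Computable.decode.comp Computable.pred) (Computable.const _)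
  · exact ⟨Encodable.encode m + 1, by omega, by simp⟩

theorem computable₂_threshold (C : ℕ) : Computable₂ (threshold C) := by
  have h : Primrec fun a : ℕ × ℕ => 2 * a.1 + a.2 + 1 :=
    Primrec.succ.comp (Primrec.nat_add.comp (Primrec.nat_mul.comp (Primrec.const 2) Primrec.fst)
      Primrec.snd)
  have h2 : Primrec fun a : ℕ × ℕ => threshold C a.1 a.2 :=
    (Primrec.nat_max.comp (Primrec.nat_mul.comp h h) (Primrec.const (2 * C))).of_eq fun a => by
      rw [threshold, sq]
  exact h2.to_comp

theorem isEffectiveThreshold_threshold (M : ℕ → Machine) :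
    IsEffectiveThreshold M (threshold 128) :=
  ⟨computable₂_threshold 128, fun _ _ _ hk _ _ h => expect_dlogProb_le M hk h⟩

end GGM

theorem theorem8p2 :
    (∃ M : ℕ → GGM.Machine, GGM.IsRecursiveEnumeration M) ∧
    (∀ M : ℕ → GGM.Machine, GGM.IsRecursiveEnumeration M → GGM.DLogEffectivelyHard M) ∧
    ∃ C : ℕ, 1 ≤ C ∧ GGM.IsPolyTime (GGM.threshold C) ∧
      ∀ M : ℕ → GGM.Machine, GGM.IsRecursiveEnumeration M →
        GGM.IsEffectiveThreshold M (GGM.threshold C) :=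
  ⟨GGM.exists_isRecursiveEnumeration,
    fun M _ => ⟨GGM.threshold 128, GGM.isEffectiveThreshold_threshold M⟩,
    128, by norm_num, GGM.isPolyTime_threshold,
    fun M _ => GGM.isEffectiveThreshold_threshold M⟩
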